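/- **Setting.** Let $U$ be a totally ordered set of items. An array of size $m$ has $m$ slots, each free or holding one item, and the items present must appear in increasing order from left to right. A (randomized, online) list-labeling algorithm draws its random bits once, independently of the input; it is given a sorted initial array and then a sequence of new, pairwise distinct items, fixed in advance by an oblivious adversary. After each insertion it must output a sorted array of the same size that contains exactly the initial items and the items inserted so far; this array may depend only on the random bits, the array size, the initial array and the items inserted so far. The cost of an insertion is the number of items already present whose slot changes. We say that the algorithm inserts $n$ items into an array of size $m$ that already contains $k$ items at amortized expected cost at most $c$ if, for every sorted initial array of size $m$ with $k$ items and every sequence of $n$ new distinct items, it carries out the $n$ insertions correctly for every outcome of the random bits, and the expected total cost of the $n$ insertions is at most $n\,c$. **Lemma.** There is an absolute constant $C>0$ such that the following holds. Let $t$ be a function on the positive integers that is non-decreasing and satisfies $t(n')\ge 1$ for all $n'\ge 1$. Suppose that a list-labeling algorithm $A'$, for every $n'\ge 1$, inserts $n'$ items into an initially empty array of size $2n'$ at amortized expected cost at most $t(n')$. Then for every fixed $\delta\in(0,1/2]$ there is a list-labeling algorithm $A$ that, for every $m\ge 1$, inserts $\lceil \delta m/3\rceil$ items into an array of size $m$ that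 already contains $\lfloor(1-\delta)m\rfloor$ items, at amortized expected cost at most $$C\left(\frac{t(m)}{\delta}+\frac1\delta\right).$$ -/

import Mathlib

open MeasureTheory
open scoped ENNReal

universe u v

namespace ListLabeling

/-- An array with `m` slots; every slot is free (`none`) or holds one item. -/
abbrev SlotArray (U : Type u) (m : ℕ) : Type u := Fin m → Option U

namespace SlotArray

variable {U : Type u} {m : ℕ}

/-- The set of items stored in the array. -/
def items (a : SlotArray U m) : Set U := {x | ∃ i, a i = some x}

/-- The items appear in strictly increasing order from left to right
(in particular, every item occupies only one slot). -/
def Sorted [LinearOrder U] (a : SlotArray U m) : Prop :=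
  ∀ i j x y, i < j → a i = some x → a j = some y → x < y

/-- The number of items whose slot changes when the array `a` is replaced by the array `b`. -/
noncomputable def moves (a b : SlotArray U m) : ℕ :=
  Set.ncard {x | ∃ i j, a i = some x ∧ b j = some x ∧ i ≠ j}

end SlotArray

/-- A randomized online insertion algorithm on items from `U`. It draws a random seed once, from a
law that does not depend on the input. For an array size `m`, an initial array, and the list of the
items that have been inserted so far, in the order of their insertion, it then determines the
current array. -/
structure Algorithm (U : Type u) where
  Seed : Type v
  [seedSpace : MeasurableSpace Seed]
  law : Measure Seed
  [law_prob : IsProbabilityMeasure law]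
  place : Seed → (m : ℕ) → SlotArray U m → List U → SlotArray U m
  /-- Measurability with respect to the discrete sigma-algebra on arrays. -/
  place_measurable : ∀ (m : ℕ) (init : SlotArray U m) (xs : List U),
    @Measurable Seed (SlotArray U m) seedSpace ⊤ (fun ω => place ω m init xs)

attribute [instance] Algorithm.seedSpace Algorithm.law_prob

namespace Algorithm

variable {U : Type u}

/-- The array after the first `i` insertions of the input sequence `xs`, started from `init`. It
depends on `xs` only through its first `i` items. -/
def arrayAfter (A : Algorithm.{u, v} U) (ω : A.Seed) {m : ℕ} (init : SlotArray U m)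
    (xs : List U) : ℕ → SlotArray U m
  | 0 => init
  | i + 1 => A.place ω m init (xs.take (i + 1))

/-- The total number of item moves during the insertions of the items of `xs`. -/
noncomputable def totalCost (A : Algorithm.{u, v} U) (ω : A.Seed) {m : ℕ}
    (init : SlotArray U m) (xs : List U) : ℕ :=
  ∑ i ∈ Finset.range xs.length,
    (A.arrayAfter ω init xs i).moves (A.arrayAfter ω init xs (i + 1))

/-- `A.CanInsert m k n c`: for every sorted array of size `m` with `k` items, and every sequence of
`n` new distinct items (fixed independently of the seed), the algorithm `A` always keeps the array
sorted and containing exactly the current items, and the expected total cost of the `n` insertions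
is at most `n * c`, that is, the amortized expected cost is at most `c`. -/
def CanInsert [LinearOrder U] (A : Algorithm.{u, v} U) (m k n : ℕ) (c : ℝ) : Prop :=
  ∀ init : SlotArray U m, init.Sorted → init.items.ncard = k →
    ∀ xs : List U, xs.length = n → xs.Nodup → (∀ x ∈ xs, x ∉ init.items) →
      (∀ (ω : A.Seed), ∀ i ≤ n,
        (A.arrayAfter ω init xs i).Sorted ∧
        (A.arrayAfter ω init xs i).items = init.items ∪ {x | x ∈ xs.take i}) ∧
      ∫⁻ ω, (A.totalCost ω init xs : ℝ≥0∞) ∂A.law ≤ ENNReal.ofReal (n * c)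

end Algorithm

end ListLabeling

/-!
The algorithm `A` runs `A'` on a small array and inflates that array to size `m`.

At every moment the present items are split into a set `O` of *anchors*, which are the items held by
the simulated array of `A'`, and a set `N` of the remaining *fillers*. If `a` is the simulated array,
an item `y` goes to the slot whose one-based number is `a.height y + #{x ∈ N | x ≤ y}`, where
`a.height y` is the one-based slot in `a` of the largest anchor `≤ y`. This is strictly increasing
in `y` (`slotNumber_strictMonoOn`), and it fits into `m` slots as soon as the size of `a` plus `#N`
is at most `m` (`slotNumber_le`).

Initially about every `6 / δ`-th item is an anchor (`exists_anchors`), so at most `B = O(1 / δ)`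
fillers lie between consecutive anchors. To insert `z`, the largest item `w` of the run of fillers
starting at `z` (possibly `z` itself) becomes an anchor, and is inserted by `A'`; `z` takes its place
among the fillers. Thus `#N` never changes and runs of fillers do not grow
(`FillerBound.evict`). Outside `[z, w]`, which contains at most `B` old items, neither
`#{x ∈ N | x ≤ y}` nor the largest anchor below `y` changes, so `y` can move only if that anchor is
moved by `A'`; at most `B + 1` items share an anchor. Hence an insertion costs at most
`B + (B + 1) * (moves of A')` (`moves_arrange_evict_le`). `A'` handles `O(δ m)` items, so the expected
total cost is `O(δ m) * (1 + t m) / δ`, plus at most `m` for the first insertion, which rearranges the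
arbitrary initial array. If `δ m < 12`, then rebuilding the array each time costs at most
`m = O(1 / δ)` per insertion.
-/

namespace ListLabeling

open Finset

/-! ### Arrays given by slot numbers -/

namespace SlotArray

variable {U : Type u} {m : ℕ}

open Classical in
/-- The items of an array, as a finite set. -/
noncomputable def itemFinset (a : SlotArray U m) : Finset U :=
  (univ.image a).eraseNone

/-- The array without items. -/
def empty (U : Type u) (m : ℕ) : SlotArray U m := fun _ => none

lemma empty_items : (empty U m).items = ∅ := by
  ext x
  simp [empty, items]

lemma mem_itemFinset {a : SlotArray U m} {x : U} : x ∈ a.itemFinset ↔ ∃ i, a i = some x := by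
  simp [itemFinset]

lemma coe_itemFinset (a : SlotArray U m) : (a.itemFinset : Set U) = a.items := by
  ext x
  simp [mem_itemFinset, items]

lemma card_itemFinset_le (a : SlotArray U m) : #a.itemFinset ≤ m := by
  classical
  have h : (a.itemFinset).image some ⊆ univ.image a := by
    intro x hx
    obtain ⟨y, hy, rfl⟩ := mem_image.1 hx
    obtain ⟨i, hi⟩ := mem_itemFinset.1 hy
    exact mem_image.2 ⟨i, mem_univ _, hi⟩
  rw [← card_image_of_injective _ (Option.some_injective U)]
  exact (card_le_card h).trans (card_image_le.trans (by simp))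

lemma moves_le (a b : SlotArray U m) : a.moves b ≤ m := by
  refine le_trans ?_ a.card_itemFinset_le
  rw [← Set.ncard_coe_finset, coe_itemFinset]
  refine Set.ncard_le_ncard ?_ (by rw [← coe_itemFinset]; exact finite_toSet _)
  rintro x ⟨i, _, hi, _⟩
  exact ⟨i, hi⟩

variable [LinearOrder U]

lemma empty_sorted : (empty U m).Sorted := by
  intro i j x y _ h
  simp [empty] at h

open Classical in
/-- The array of size `m` in which `y ∈ F` occupies the slot with one-based number `p y`. -/
noncomputable def arrange (m : ℕ) (F : Finset U) (p : U → ℕ) : SlotArray U m := fun j =>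
  if h : ∃ y ∈ F, p y = j + 1 then some h.choose else none

lemma arrange_eq_some {F : Finset U} {p : U → ℕ} (hp : StrictMonoOn p F) {j : Fin m} {y : U} :
    arrange m F p j = some y ↔ y ∈ F ∧ p y = j + 1 := by
  unfold arrange
  split_ifs with h
  · have hc := h.choose_spec
    constructor
    · intro e
      rw [Option.some.injEq] at e
      rwa [e] at hc
    · rintro ⟨hy, hpy⟩
      rw [hp.injOn hc.1 hy (hc.2.trans hpy.symm)]
  · simp only [false_iff]
    exact fun hy => h ⟨y, hy⟩

lemma arrange_sorted {F : Finset U} {p : U → ℕ} (hp : StrictMonoOn p F) :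
    (arrange m F p).Sorted := by
  intro i j x y hij hx hy
  rw [arrange_eq_some hp] at hx hy
  refine (hp.lt_iff_lt hx.1 hy.1).1 ?_
  have : i.val < j.val := hij
  omega

lemma arrange_items {F : Finset U} {p : U → ℕ} (hp : StrictMonoOn p F)
    (hpos : ∀ y ∈ F, 1 ≤ p y) (hle : ∀ y ∈ F, p y ≤ m) : (arrange m F p).items = F := by
  ext y
  simp only [items, Set.mem_ofPred_eq, arrange_eq_some hp, mem_coe]
  constructor
  · rintro ⟨_, h, _⟩
    exact h
  · intro h
    have h1 := hpos y h
    have h2 := hle y h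
    exact ⟨⟨p y - 1, by omega⟩, h, by simp only; omega⟩

lemma moves_arrange_le {F F' : Finset U} {p p' : U → ℕ} (hp : StrictMonoOn p F)
    (hp' : StrictMonoOn p' F') :
    (arrange m F p).moves (arrange m F' p') ≤ #{y ∈ F | p y ≠ p' y} := by
  rw [← Set.ncard_coe_finset]
  refine Set.ncard_le_ncard ?_ (finite_toSet _)
  rintro y ⟨i, j, hi, hj, hij⟩
  rw [arrange_eq_some hp] at hi
  rw [arrange_eq_some hp'] at hj
  simp only [coe_filter, Set.mem_ofPred_eq]
  refine ⟨hi.1, fun h => hij (Fin.ext ?_)⟩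
  omega

/-! ### Inflating an array by fillers -/

variable {M : ℕ}

open Classical in
/-- The one-based number of the last slot holding an item `≤ y`, and `0` if there is none. -/
noncomputable def height (a : SlotArray U M) (y : U) : ℕ :=
  ({i | ∃ x ≤ y, a i = some x} : Finset (Fin M)).sup fun i => i.val + 1

lemma height_le (a : SlotArray U M) (y : U) : a.height y ≤ M :=
  Finset.sup_le fun i _ => i.isLt

lemma height_mono (a : SlotArray U M) : Monotone a.height := by
  intro y y' h
  refine Finset.sup_mono fun i hi => ?_
  simp only [mem_filter, mem_univ, true_and] at hi ⊢
  obtain ⟨x, hx, e⟩ := hi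
  exact ⟨x, hx.trans h, e⟩

lemma lt_height {a : SlotArray U M} {i : Fin M} {x y : U} (hi : a i = some x) (hx : x ≤ y) :
    i.val < a.height y := by
  classical
  exact Finset.le_sup (f := fun i : Fin M => i.val + 1)
    (mem_filter.2 ⟨mem_univ i, x, hx, hi⟩)

lemma Sorted.height_le_of_forall {a : SlotArray U M} (ha : a.Sorted) {i : Fin M} {x y : U}
    (hi : a i = some x) (h : ∀ x' ∈ a.items, x' ≤ y → x' ≤ x) : a.height y ≤ i.val + 1 := by
  refine Finset.sup_le fun j hj => ?_
  simp only [mem_filter, mem_univ, true_and] at hj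
  obtain ⟨x', hx', hj⟩ := hj
  by_contra! hlt
  exact absurd (ha i j x x' (Fin.lt_def.2 (by omega)) hi hj) (h x' ⟨j, hj⟩ hx').not_gt

lemma Sorted.height_eq {a : SlotArray U M} (ha : a.Sorted) {i : Fin M} {x y : U}
    (hi : a i = some x) (hx : x ≤ y) (h : ∀ x' ∈ a.items, x' ≤ y → x' ≤ x) :
    a.height y = i.val + 1 :=
  le_antisymm (ha.height_le_of_forall hi h) (lt_height hi hx)

lemma Sorted.height_lt {a : SlotArray U M} (ha : a.Sorted) {y y' : U} (h : y < y')
    (hy' : y' ∈ a.items) : a.height y < a.height y' := by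
  obtain ⟨j, hj⟩ := hy'
  refine lt_of_le_of_lt (Finset.sup_le fun i hi => ?_) (lt_height hj le_rfl)
  simp only [mem_filter, mem_univ, true_and] at hi
  obtain ⟨x, hx, hi⟩ := hi
  by_contra! hlt
  rcases (Nat.lt_succ_iff.1 hlt).eq_or_lt with e | hji
  · rw [← Fin.ext e, hj, Option.some.injEq] at hi
    exact absurd hx (hi ▸ h.not_ge)
  · exact absurd (ha j i y' x hji hj hi) (hx.trans h.le).not_gt

lemma height_eq_zero {a : SlotArray U M} {y : U} (h : ∀ x ∈ a.items, ¬ x ≤ y) :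
    a.height y = 0 := by
  refine Nat.le_zero.1 (Finset.sup_le fun i hi => ?_)
  simp only [mem_filter, mem_univ, true_and] at hi
  obtain ⟨x, hx, hi⟩ := hi
  exact absurd hx (h x ⟨i, hi⟩)

/-- The one-based slot of `y` in the array obtained from `a` by making room for each filler
`x ∈ N` behind the largest item of `a` below `x`. -/
noncomputable def slotNumber (a : SlotArray U M) (N : Finset U) (y : U) : ℕ :=
  a.height y + #{x ∈ N | x ≤ y}

lemma slotNumber_strictMonoOn {a : SlotArray U M} (ha : a.Sorted) {F N : Finset U}
    (hF : ∀ y ∈ F, y ∈ a.items ∨ y ∈ N) : StrictMonoOn (a.slotNumber N) F := by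
  intro y _ y' hy' hlt
  have hsub : ({x ∈ N | x ≤ y} : Finset U) ⊆ {x ∈ N | x ≤ y'} :=
    fun x hx => by
      rw [mem_filter] at hx ⊢
      exact ⟨hx.1, hx.2.trans hlt.le⟩
  rcases hF y' hy' with h | h
  · exact add_lt_add_of_lt_of_le (ha.height_lt hlt h) (card_le_card hsub)
  · refine add_lt_add_of_le_of_lt (a.height_mono hlt.le) (card_lt_card ?_)
    refine (ssubset_iff_of_subset hsub).2 ⟨y', by simp [h], ?_⟩
    simp [hlt]

lemma slotNumber_pos {a : SlotArray U M} {N : Finset U} {y : U} (hy : y ∈ a.items ∨ y ∈ N) :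
    1 ≤ a.slotNumber N y := by
  rcases hy with ⟨i, hi⟩ | h
  · exact le_add_right (Nat.one_le_of_lt (lt_height hi le_rfl))
  · exact le_add_left (card_pos.2 ⟨y, by simp [h]⟩)

lemma slotNumber_le (a : SlotArray U M) (N : Finset U) (y : U) :
    a.slotNumber N y ≤ M + #N :=
  add_le_add (a.height_le y) (card_filter_le _ _)

end SlotArray

/-! ### Anchors and fillers -/

section Anchors

variable {U : Type u} [LinearOrder U]

/-- Every set of elements of `N` that no element of `O` separates has at most `B` elements: there
are at most `B` fillers between consecutive anchors. -/
def FillerBound (O N : Finset U) (B : ℕ) : Prop :=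
  ∀ S ⊆ N, (∀ x ∈ S, ∀ y ∈ S, ∀ o ∈ O, x ≤ o → ¬ o ≤ y) → #S ≤ B

/-- Making every `B`-th element an anchor bounds the runs of the remaining elements. -/
lemma exists_anchors (F : Finset U) (B : ℕ) :
    ∃ R ⊆ F, #R * B ≤ #F ∧ FillerBound R (F \ R) B := by
  -- The induction also keeps track of the elements above all anchors.
  suffices h : ∃ R ⊆ F, #R * B + #{x ∈ F | ∀ r ∈ R, r < x} ≤ #F ∧ #{x ∈ F | ∀ r ∈ R, r < x} ≤ B ∧
      FillerBound R (F \ R) B by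
    obtain ⟨R, hR, h1, _, h2⟩ := h
    exact ⟨R, hR, by omega, h2⟩
  induction F using Finset.induction_on_max with
  | empty => exact ⟨∅, by simp, by simp, by simp, by intro S hS; simp_all⟩
  | insert a F ha ih =>
    have haF : a ∉ F := fun h => lt_irrefl a (ha a h)
    obtain ⟨R, hRF, hcard, htail, hR⟩ := ih
    have haR : a ∉ R := fun h => haF (hRF h)
    have htail' : ({x ∈ insert a F | ∀ r ∈ R, r < x} : Finset U) =
        insert a {x ∈ F | ∀ r ∈ R, r < x} := by
      rw [filter_insert, if_pos fun r hr => ha r (hRF hr)]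
    have hcard' : #(insert a F) = #F + 1 := card_insert_of_notMem haF
    have hins : #(insert a ({x ∈ F | ∀ r ∈ R, r < x} : Finset U)) =
        #{x ∈ F | ∀ r ∈ R, r < x} + 1 := card_insert_of_notMem (by simp [haF])
    rcases lt_or_ge #{x ∈ F | ∀ r ∈ R, r < x} B with hlt | hge
    · refine ⟨R, hRF.trans (subset_insert _ _), ?_, ?_, ?_⟩
      · rw [htail', hins, hcard']
        omega
      · rw [htail', hins]
        omega
      · intro S hS hsep
        by_cases haS : a ∈ S
        · refine le_trans (card_le_card (t := insert a {x ∈ F | ∀ r ∈ R, r < x}) ?_)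
            (by omega)
          rw [← htail']
          intro x hx
          refine mem_filter.2 ⟨(mem_sdiff.1 (hS hx)).1, fun r hr => ?_⟩
          by_contra! hle
          exact hsep x hx a haS r hr hle (ha r (hRF hr)).le
        · refine hR S (fun x hx => ?_) hsep
          have := mem_sdiff.1 (hS hx)
          refine mem_sdiff.2 ⟨(mem_insert.1 this.1).resolve_left ?_, this.2⟩
          rintro rfl
          exact haS hx
    · have hempty : ({x ∈ insert a F | ∀ r ∈ insert a R, r < x} : Finset U) = ∅ := by
        refine filter_eq_empty_iff.2 fun x hx h => ?_
        have hax := h a (mem_insert_self _ _)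
        rcases mem_insert.1 hx with rfl | hx
        · exact lt_irrefl _ hax
        · exact lt_asymm hax (ha x hx)
      refine ⟨insert a R, insert_subset_insert _ hRF, ?_, ?_, ?_⟩
      · rw [hempty, card_insert_of_notMem haR, hcard', card_empty, add_mul]
        omega
      · rw [hempty]
        simp
      · intro S hS hsep
        refine hR S (fun x hx => ?_) fun x hx y hy o ho =>
          hsep x hx y hy o (mem_insert_of_mem ho)
        have := mem_sdiff.1 (hS hx)
        simp only [mem_insert, not_or] at this
        exact mem_sdiff.2 ⟨this.1.resolve_left this.2.1, this.2.2⟩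

/-- The run of fillers, including the new item `z`, that starts at `z` and ends before the next
anchor. -/
def fillerRun (O N : Finset U) (z : U) : Finset U :=
  {x ∈ insert z N | z ≤ x ∧ ∀ o ∈ O, z < o → ¬ o ≤ x}

lemma fillerRun_nonempty (O N : Finset U) (z : U) : (fillerRun O N z).Nonempty :=
  ⟨z, by simp +contextual [fillerRun]⟩

/-- The item that becomes an anchor when `z` is inserted. -/
def evict (O N : Finset U) (z : U) : U :=
  (fillerRun O N z).max' (fillerRun_nonempty O N z)

lemma evict_mem_fillerRun (O N : Finset U) (z : U) : evict O N z ∈ fillerRun O N z :=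
  max'_mem _ _

lemma evict_mem (O N : Finset U) (z : U) : evict O N z ∈ insert z N :=
  (mem_filter.1 (evict_mem_fillerRun O N z)).1

lemma le_evict (O N : Finset U) (z : U) : z ≤ evict O N z :=
  (mem_filter.1 (evict_mem_fillerRun O N z)).2.1

lemma evict_lt_of_lt {O N : Finset U} {z o : U} (ho : o ∈ O) (hz : z < o) : evict O N z < o :=
  not_le.1 ((mem_filter.1 (evict_mem_fillerRun O N z)).2.2 o ho hz)

/-- Beyond the evicted item, the next present item is an anchor. -/
lemma exists_anchor_of_evict_lt {O N : Finset U} {z y : U} (hy : y ∈ O ∨ y ∈ N)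
    (h : evict O N z < y) : ∃ o ∈ O, evict O N z < o ∧ o ≤ y := by
  have hz := (le_evict O N z).trans_lt h
  rcases hy with hy | hy
  · exact ⟨y, hy, h, le_rfl⟩
  · by_contra! hno
    refine absurd (le_max' (fillerRun O N z) y ?_) h.not_ge
    refine mem_filter.2 ⟨mem_insert_of_mem hy, hz.le, fun o ho hzo hoy => ?_⟩
    exact absurd hoy (hno o ho (evict_lt_of_lt ho hzo)).not_ge

lemma evict_notMem {O N : Finset U} (hd : Disjoint O N) {z : U} (hz : z ∉ O) :
    evict O N z ∉ O := by
  intro h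
  rcases mem_insert.1 (evict_mem O N z) with e | hN
  · exact hz (e ▸ h)
  · exact disjoint_left.1 hd h hN

lemma FillerBound.evict {O N : Finset U} {B : ℕ} (h : FillerBound O N B) (z : U) :
    FillerBound (insert (evict O N z) O) ((insert z N).erase (evict O N z)) B := by
  intro S hS hsep
  have hsepO : ∀ x ∈ S, ∀ y ∈ S, ∀ o ∈ O, x ≤ o → ¬ o ≤ y :=
    fun x hx y hy o ho => hsep x hx y hy o (mem_insert_of_mem ho)
  by_cases hzS : z ∈ S
  · have hzw : z ≠ ListLabeling.evict O N z := (mem_erase.1 (hS hzS)).1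
    have hwS : ListLabeling.evict O N z ∉ S := fun hw => (mem_erase.1 (hS hw)).1 rfl
    have hzlt := lt_of_le_of_ne (le_evict O N z) hzw
    -- Exchanging `z` for the evicted item turns `S` into a run of old fillers of the same size.
    have hT : #(insert (ListLabeling.evict O N z) (S.erase z)) = #S := by
      rw [card_insert_of_notMem fun hw => hwS (mem_of_mem_erase hw),
        card_erase_add_one hzS]
    rw [← hT]
    refine h _ ?_ ?_
    · intro x hx
      rcases mem_insert.1 hx with rfl | hx
      · exact (mem_insert.1 (evict_mem O N z)).resolve_left hzw.symm
      · have hx' := mem_erase.1 hx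
        exact (mem_insert.1 (mem_erase.1 (hS hx'.2)).2).resolve_left hx'.1
    · intro x hx y hy o ho hxo hoy
      rcases mem_insert.1 hy with rfl | hy
      · have hoz : o ≤ z := not_lt.1 fun hlt => absurd hoy (evict_lt_of_lt ho hlt).not_ge
        rcases mem_insert.1 hx with rfl | hx
        · exact absurd (hxo.trans hoz) hzlt.not_ge
        · exact hsepO x (mem_of_mem_erase hx) z hzS o ho hxo hoz
      · rcases mem_insert.1 hx with rfl | hx
        · exact hsep z hzS y (mem_of_mem_erase hy) _ (mem_insert_self _ _) hzlt.le (hxo.trans hoy)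
        · exact hsepO x (mem_of_mem_erase hx) y (mem_of_mem_erase hy) o ho hxo hoy
  · refine h S (fun x hx => ?_) hsepO
    refine (mem_insert.1 (mem_erase.1 (hS hx)).2).resolve_left ?_
    rintro rfl
    exact hzS hx

/-- At most `B` fillers share an anchor with it. -/
lemma FillerBound.card_sharing_le {O N : Finset U} {B : ℕ} (h : FillerBound O N B) (o : U) :
    #{y ∈ O ∪ N | o ≤ y ∧ ∀ o' ∈ O, o < o' → ¬ o' ≤ y} ≤ B + 1 := by
  set T : Finset U := {y ∈ O ∪ N | o ≤ y ∧ ∀ o' ∈ O, o < o' → ¬ o' ≤ y}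
  have hT : ∀ y ∈ T.erase o, y ∈ N ∧ o < y ∧ ∀ o' ∈ O, o < o' → ¬ o' ≤ y := by
    intro y hy
    obtain ⟨hne, hy⟩ := mem_erase.1 hy
    obtain ⟨hF, hle, hno⟩ := mem_filter.1 hy
    have hlt := lt_of_le_of_ne hle hne.symm
    exact ⟨(mem_union.1 hF).resolve_left fun hO => hno y hO hlt le_rfl, hlt, hno⟩
  have hle : #(T.erase o) ≤ B := h _ (fun y hy => (hT y hy).1) fun x hx y hy o' ho' h1 h2 =>
    (hT y hy).2.2 o' ho' ((hT x hx).2.1.trans_le h1) h2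
  have := pred_card_le_card_erase (s := T) (a := o)
  omega

/-! ### The cost of one insertion -/

open SlotArray

/-- An item outside the interval from the inserted to the evicted item keeps its slot if the largest
anchor below it does. -/
lemma slotNumber_evict_eq {M : ℕ} {O N : Finset U} {z y : U} (hy : y ∈ O ∪ N)
    (hz : z ∉ O ∪ N) {a b : SlotArray U M} (ha : a.Sorted) (hb : b.Sorted)
    (haO : a.items = O) (hbO : b.items = insert (evict O N z) (O : Set U))
    (hyz : z ≤ y → ¬ y ≤ evict O N z)
    (hmove : ∀ o ∈ O, o ≤ y → (∀ o' ∈ O, o < o' → ¬ o' ≤ y) →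
      ∀ i j, a i = some o → b j = some o → i = j) :
    a.slotNumber N y = b.slotNumber ((insert z N).erase (evict O N z)) y := by
  have hyON := mem_union.1 hy
  have hzN : z ∉ N := fun h => hz (mem_union_right _ h)
  have hzw := le_evict O N z
  unfold slotNumber
  congr 1
  · rcases ({o ∈ O | o ≤ y} : Finset U).eq_empty_or_nonempty with he | hne
    · have hno : ∀ o ∈ O, ¬ o ≤ y := filter_eq_empty_iff.1 he
      rw [height_eq_zero, height_eq_zero]
      · rw [hbO]
        rintro x (rfl | hx) hxy
        · rcases hxy.eq_or_lt with e | hlt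
          · exact hyz (hzw.trans_eq e) e.ge
          · obtain ⟨o, ho, _, hoy⟩ := exists_anchor_of_evict_lt hyON hlt
            exact hno o ho hoy
        · exact hno x hx hxy
      · rw [haO]
        exact hno
    · obtain ⟨o, ho, hmax⟩ := exists_max_image _ id hne
      obtain ⟨hoO, hoy⟩ := mem_filter.1 ho
      have hmax' : ∀ o' ∈ O, o' ≤ y → o' ≤ o := fun o' h1 h2 => hmax o' (mem_filter.2 ⟨h1, h2⟩)
      obtain ⟨i, hi⟩ : o ∈ a.items := by rw [haO]; exact hoO
      obtain ⟨j, hj⟩ : o ∈ b.items := by rw [hbO]; exact Or.inr hoO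
      have hij := hmove o hoO hoy (fun o' h1 h2 h3 => absurd (hmax' o' h1 h3) h2.not_ge) i j hi hj
      rw [ha.height_eq hi hoy, hb.height_eq hj hoy, hij]
      · rw [hbO]
        rintro x (rfl | hx) hxy
        · rcases hxy.eq_or_lt with e | hlt
          · exact absurd e.ge (hyz (hzw.trans_eq e))
          · obtain ⟨o', ho', hlt', hoy'⟩ := exists_anchor_of_evict_lt hyON hlt
            exact hlt'.le.trans (hmax' o' ho' hoy')
        · exact hmax' x hx hxy
      · rw [haO]
        exact hmax'
  · rw [filter_erase, filter_insert]
    by_cases hzy : z ≤ y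
    · have hwy := not_le.1 (hyz hzy)
      rw [if_pos hzy, card_erase_of_mem, card_insert_of_notMem (by simp [hzN]),
        Nat.add_sub_cancel]
      rcases mem_insert.1 (evict_mem O N z) with e | h
      · rw [e]
        exact mem_insert_self _ _
      · exact mem_insert_of_mem (mem_filter.2 ⟨h, hwy.le⟩)
    · rw [if_neg hzy, erase_eq_of_notMem]
      intro h
      exact hzy (hzw.trans (mem_filter.1 h).2)

lemma moves_arrange_evict_le {m M B : ℕ} {O N F F' : Finset U} {z : U} (hF : O ∪ N = F)
    (hF' : F' = insert z F) (hz : z ∉ F) (hB : FillerBound O N B)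
    {a b : SlotArray U M} (ha : a.Sorted) (hb : b.Sorted)
    (haO : a.items = O) (hbO : b.items = insert (evict O N z) (O : Set U)) :
    (arrange m F (a.slotNumber N)).moves
      (arrange m F' (b.slotNumber ((insert z N).erase (evict O N z)))) ≤
      B + (B + 1) * a.moves b := by
  classical
  subst hF hF'
  set w := evict O N z with hw
  refine (moves_arrange_le (slotNumber_strictMonoOn ha ?_) (slotNumber_strictMonoOn hb ?_)).trans ?_
  · intro y hy
    rw [haO]
    exact mem_union.1 hy
  · intro y hy
    rw [hbO]
    by_cases hyw : y = w
    · exact Or.inl (Or.inl hyw)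
    · rcases mem_insert.1 hy with rfl | hy
      · exact Or.inr (mem_erase.2 ⟨hyw, mem_insert_self _ _⟩)
      · rcases mem_union.1 hy with hy | hy
        · exact Or.inl (Or.inr hy)
        · exact Or.inr (mem_erase.2 ⟨hyw, mem_insert_of_mem hy⟩)
  have hfin : {x | ∃ i j, a i = some x ∧ b j = some x ∧ i ≠ j}.Finite := by
    refine (finite_toSet O).subset ?_
    rintro x ⟨i, _, hi, _⟩
    rw [← haO]
    exact ⟨i, hi⟩
  set K : Finset U := hfin.toFinset with hK
  have hKcard : #K = a.moves b := by
    rw [SlotArray.moves, Set.ncard_eq_toFinset_card _ hfin]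
  set I : Finset U := {y ∈ O ∪ N | z ≤ y ∧ y ≤ w} with hI
  have hIN : ∀ y ∈ I, y ∈ N ∧ z ≤ y ∧ y ≤ w := by
    intro y hy
    obtain ⟨hy, h1, h2⟩ := mem_filter.1 hy
    refine ⟨(mem_union.1 hy).resolve_left fun hO => ?_, h1, h2⟩
    refine absurd h2 (evict_lt_of_lt hO (lt_of_le_of_ne h1 ?_)).not_ge
    rintro rfl
    exact hz hy
  have hIcard : #I ≤ B := by
    refine hB I (fun y hy => (hIN y hy).1) fun x hx y hy o ho hxo hoy => ?_
    refine absurd (hoy.trans (hIN y hy).2.2) (evict_lt_of_lt ho (lt_of_le_of_ne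
      ((hIN x hx).2.1.trans hxo) ?_)).not_ge
    rintro rfl
    exact hz (mem_union_left _ ho)
  let T : U → Finset U := fun o => {y ∈ O ∪ N | o ≤ y ∧ ∀ o' ∈ O, o < o' → ¬ o' ≤ y}
  have hsub : ({y ∈ O ∪ N | a.slotNumber N y ≠ b.slotNumber ((insert z N).erase w) y} : Finset U) ⊆
      I ∪ K.biUnion T := by
    intro y hy
    obtain ⟨hy, hne⟩ := mem_filter.1 hy
    by_contra hnot
    simp only [mem_union, mem_biUnion, not_or, not_exists, not_and] at hnot
    refine hne (slotNumber_evict_eq hy hz ha hb haO hbO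
      (fun h1 h2 => hnot.1 (mem_filter.2 ⟨hy, h1, h2⟩)) ?_)
    intro o _ hoy hno i j hi hj
    by_contra hij
    exact hnot.2 o (hfin.mem_toFinset.2 ⟨i, j, hi, hj, hij⟩) (mem_filter.2 ⟨hy, hoy, hno⟩)
  calc _ ≤ #(I ∪ K.biUnion T) := card_le_card hsub
    _ ≤ #I + #(K.biUnion T) := card_union_le _ _
    _ ≤ B + #K * (B + 1) :=
        add_le_add hIcard (card_biUnion_le_card_mul _ _ _ fun o _ => hB.card_sharing_le o)
    _ = B + (B + 1) * a.moves b := by rw [hKcard, mul_comm]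

/-! ### Sequences of insertions -/

/-- The anchors and the fillers after the insertion of a list of items. -/
def split : Finset U → Finset U → List U → Finset U × Finset U
  | O, N, [] => (O, N)
  | O, N, z :: zs => split (insert (evict O N z) O) ((insert z N).erase (evict O N z)) zs

/-- The items that successively become anchors during the insertion of a list of items. -/
def evictions : Finset U → Finset U → List U → List U
  | _, _, [] => []
  | O, N, z :: zs => evict O N z ::
      evictions (insert (evict O N z) O) ((insert z N).erase (evict O N z)) zs

lemma evictions_take (zs : List U) (O N : Finset U) (i : ℕ) :
    evictions O N (zs.take i) = (evictions O N zs).take i := by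
  induction zs generalizing O N i with
  | nil => simp [evictions]
  | cons z zs ih => cases i <;> simp [evictions, ih]

lemma length_evictions (zs : List U) (O N : Finset U) :
    (evictions O N zs).length = zs.length := by
  induction zs generalizing O N with
  | nil => rfl
  | cons z zs ih => simp [evictions, ih]

lemma split_concat (zs : List U) (z : U) (O N : Finset U) :
    split O N (zs ++ [z]) =
      (insert (evict (split O N zs).1 (split O N zs).2 z) (split O N zs).1,
        (insert z (split O N zs).2).erase (evict (split O N zs).1 (split O N zs).2 z)) := by
  induction zs generalizing O N with
  | nil => rfl
  | cons _ zs ih => exact ih _ _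

lemma split_fst (zs : List U) (O N : Finset U) :
    ((split O N zs).1 : Set U) = (O : Set U) ∪ {x | x ∈ evictions O N zs} := by
  induction zs generalizing O N with
  | nil => simp [split, evictions]
  | cons z zs ih =>
    rw [split, ih]
    ext x
    simp only [coe_insert, evictions, List.mem_cons, Set.mem_union, Set.mem_insert_iff,
      Set.mem_ofPred_eq, mem_coe]
    tauto

lemma evict_union (O N : Finset U) (z : U) :
    insert (evict O N z) O ∪ (insert z N).erase (evict O N z) = insert z (O ∪ N) := by
  have h := evict_mem O N z
  ext x
  simp only [mem_union, mem_insert, mem_erase] at h ⊢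
  by_cases hx : x = evict O N z
  · subst hx
    tauto
  · tauto

lemma split_union (zs : List U) (O N : Finset U) :
    (split O N zs).1 ∪ (split O N zs).2 = (O ∪ N) ∪ zs.toFinset := by
  induction zs generalizing O N with
  | nil => simp [split]
  | cons z zs ih =>
    rw [split, ih, evict_union]
    simp [union_comm, union_left_comm]

lemma FillerBound.split {O N : Finset U} {B : ℕ} (h : FillerBound O N B) (zs : List U) :
    FillerBound (split O N zs).1 (split O N zs).2 B := by
  induction zs generalizing O N with
  | nil => exact h
  | cons z zs ih => exact ih (h.evict z)

lemma disjoint_evict {O N : Finset U} (hd : Disjoint O N) {z : U} (hz : z ∉ O) :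
    Disjoint (insert (evict O N z) O) ((insert z N).erase (evict O N z)) := by
  rw [disjoint_left]
  intro x hx hx'
  obtain ⟨hne, hx'⟩ := mem_erase.1 hx'
  have hxO := (mem_insert.1 hx).resolve_left hne
  rcases mem_insert.1 hx' with rfl | hN
  · exact hz hxO
  · exact disjoint_left.1 hd hxO hN

lemma notMem_evict_union {O N : Finset U} {z : U} {zs : List U} (hnd : (z :: zs).Nodup)
    (hnew : ∀ x ∈ z :: zs, x ∉ O ∪ N) :
    ∀ x ∈ zs, x ∉ insert (evict O N z) O ∪ (insert z N).erase (evict O N z) := by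
  intro x hx
  rw [evict_union, mem_insert, not_or]
  refine ⟨?_, hnew x (List.mem_cons_of_mem _ hx)⟩
  rintro rfl
  exact (List.nodup_cons.1 hnd).1 hx

lemma card_split_snd {O N : Finset U} {zs : List U} (hnd : zs.Nodup)
    (hnew : ∀ x ∈ zs, x ∉ O ∪ N) : #(split O N zs).2 = #N := by
  induction zs generalizing O N with
  | nil => rfl
  | cons z zs ih =>
    rw [split, ih (List.nodup_cons.1 hnd).2 (notMem_evict_union hnd hnew),
      card_erase_of_mem (evict_mem O N z), card_insert_of_notMem, Nat.add_sub_cancel]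
    exact fun h => hnew z List.mem_cons_self (mem_union_right _ h)

lemma nodup_evictions {O N : Finset U} (hd : Disjoint O N) {zs : List U} (hnd : zs.Nodup)
    (hnew : ∀ x ∈ zs, x ∉ O ∪ N) :
    (evictions O N zs).Nodup ∧ ∀ x ∈ evictions O N zs, x ∉ O := by
  induction zs generalizing O N with
  | nil => simp [evictions]
  | cons z zs ih =>
    have hz : z ∉ O := fun h => hnew z List.mem_cons_self (mem_union_left _ h)
    obtain ⟨h1, h2⟩ := ih (disjoint_evict hd hz) (List.nodup_cons.1 hnd).2
      (notMem_evict_union hnd hnew)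
    refine ⟨List.nodup_cons.2 ⟨fun h => h2 _ h (mem_insert_self _ _), h1⟩, ?_⟩
    intro x hx
    rcases List.mem_cons.1 hx with rfl | hx
    · exact evict_notMem hd hz
    · exact fun h => h2 x hx (mem_insert_of_mem h)

end Anchors
/-! ### The inflated algorithm -/

namespace Algorithm

open SlotArray

variable {U : Type u} [LinearOrder U]

open Classical in
/-- The algorithm that, for array sizes with `P m`, inserts the initial anchors `R m init` and then
the evicted items by `A'` into an empty array with two slots for each of `#(R m init) + n m` items,
and inflates the result by the fillers. For the other array sizes it packs all items to the left. -/
noncomputable def inflate (A' : Algorithm.{u, v} U) (P : ℕ → Prop) (n : ℕ → ℕ)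
    (R : ∀ m, SlotArray U m → Finset U) : Algorithm.{u, v} U where
  Seed := A'.Seed
  law := A'.law
  place ω m init xs :=
    if P m then
      arrange m (init.itemFinset ∪ xs.toFinset)
        ((A'.place ω (2 * (#(R m init) + n m)) (empty U _)
          ((R m init).toList ++ evictions (R m init) (init.itemFinset \ R m init) xs)).slotNumber
            (split (R m init) (init.itemFinset \ R m init) xs).2)
    else
      arrange m (init.itemFinset ∪ xs.toFinset)
        ((empty U 0).slotNumber (init.itemFinset ∪ xs.toFinset))
  place_measurable m init xs := by
    split_ifs
    · intro s _
      exact A'.place_measurable (2 * (#(R m init) + n m)) (empty U _)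
        ((R m init).toList ++ evictions (R m init) (init.itemFinset \ R m init) xs)
        (MeasurableSpace.measurableSet_top (s := (fun a : SlotArray U (2 * (#(R m init) + n m)) =>
          arrange m (init.itemFinset ∪ xs.toFinset)
            (a.slotNumber (split (R m init) (init.itemFinset \ R m init) xs).2)) ⁻¹' s))
    · exact measurable_const

variable {A' : Algorithm.{u, v} U} {P : ℕ → Prop} {n : ℕ → ℕ}
  {R : ∀ m, SlotArray U m → Finset U} {m : ℕ} {init : SlotArray U m} {xs : List U}

lemma coe_itemFinset_union_take (init : SlotArray U m) (xs : List U) (i : ℕ) :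
    ((init.itemFinset ∪ (xs.take i).toFinset : Finset U) : Set U) =
      init.items ∪ {x | x ∈ xs.take i} := by
  ext x
  simp [← coe_itemFinset]

lemma card_itemFinset_union_take_le (init : SlotArray U m) (xs : List U) (i : ℕ) :
    #(init.itemFinset ∪ (xs.take i).toFinset) ≤ init.items.ncard + xs.length := by
  refine (card_union_le _ _).trans (add_le_add ?_ ?_)
  · rw [← coe_itemFinset, Set.ncard_coe_finset]
  · exact (List.toFinset_card_le _).trans (List.length_take_le' _ _)

lemma inflate_packed_spec (hP : ¬ P m) (hinit : init.Sorted)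
    (hm : init.items.ncard + xs.length ≤ m) (ω : A'.Seed) (i : ℕ) :
    ((A'.inflate P n R).arrayAfter ω init xs i).Sorted ∧
      ((A'.inflate P n R).arrayAfter ω init xs i).items = init.items ∪ {x | x ∈ xs.take i} := by
  cases i with
  | zero => simpa [arrayAfter] using hinit
  | succ i =>
    have hmono : StrictMonoOn ((empty U 0).slotNumber
        (init.itemFinset ∪ (xs.take (i + 1)).toFinset))
        ((init.itemFinset ∪ (xs.take (i + 1)).toFinset : Finset U) : Set U) :=
      slotNumber_strictMonoOn empty_sorted fun y hy => Or.inr hy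
    simp only [arrayAfter, inflate, if_neg hP]
    refine ⟨arrange_sorted hmono, ?_⟩
    rw [arrange_items hmono (fun y hy => slotNumber_pos (Or.inr hy)), coe_itemFinset_union_take]
    intro y _
    have h1 := slotNumber_le (empty U 0)
      (init.itemFinset ∪ (xs.take (i + 1)).toFinset) y
    have h2 := card_itemFinset_union_take_le init xs (i + 1)
    omega

/-- An insertion never costs more than the size of the array, since no slot holds two items. -/
lemma canInsert_of_correct {A : Algorithm.{u, v} U} {k l : ℕ} {c : ℝ} (hc : m ≤ c)
    (hA : ∀ init : SlotArray U m, init.Sorted → init.items.ncard = k → ∀ xs : List U,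
      xs.length = l → ∀ (ω : A.Seed) (i : ℕ), (A.arrayAfter ω init xs i).Sorted ∧
        (A.arrayAfter ω init xs i).items = init.items ∪ {x | x ∈ xs.take i}) :
    A.CanInsert m k l c := by
  intro init hinit hk xs hlen _ _
  refine ⟨fun ω i _ => hA init hinit hk xs hlen ω i, ?_⟩
  have hcost : ∀ ω, (A.totalCost ω init xs : ℝ≥0∞) ≤ ((l * m : ℕ) : ℝ≥0∞) := by
    intro ω
    refine Nat.cast_le.2 ((Finset.sum_le_card_nsmul _ _ m fun i _ => moves_le _ _).trans ?_)
    simp [hlen]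
  refine (lintegral_mono hcost).trans ?_
  rw [lintegral_const, measure_univ, mul_one, ← ENNReal.ofReal_natCast, Nat.cast_mul]
  exact ENNReal.ofReal_le_ofReal (mul_le_mul_of_nonneg_left hc (Nat.cast_nonneg _))

lemma canInsert_inflate_packed (hP : ¬ P m) {k l : ℕ} (hm : k + l ≤ m) {c : ℝ} (hc : m ≤ c) :
    (A'.inflate P n R).CanInsert m k l c := by
  refine canInsert_of_correct hc ?_
  intro init hinit hk xs hlen ω i
  have hfit : init.items.ncard + xs.length ≤ m := by omega
  exact inflate_packed_spec (A' := A') hP hinit hfit ω i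

lemma arrayAfter_inflate (hP : P m) (ω : A'.Seed) (i : ℕ) :
    (A'.inflate P n R).arrayAfter ω init xs (i + 1) =
      arrange m (init.itemFinset ∪ (xs.take (i + 1)).toFinset)
        ((A'.arrayAfter ω (empty U (2 * (#(R m init) + n m)))
          ((R m init).toList ++ evictions (R m init) (init.itemFinset \ R m init) xs)
            (#(R m init) + (i + 1))).slotNumber
            (split (R m init) (init.itemFinset \ R m init) (xs.take (i + 1))).2) := by
  have h : ((R m init).toList ++ evictions (R m init) (init.itemFinset \ R m init) xs).take
      (#(R m init) + i + 1) =
      (R m init).toList ++ evictions (R m init) (init.itemFinset \ R m init) (xs.take (i + 1)) := by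
    rw [evictions_take, add_assoc, ← length_toList, List.take_length_add_append]
  rw [← add_assoc]
  simp only [arrayAfter, inflate, if_pos hP, h]

/-- If the simulated run of `A'` is correct, then so is the inflated run, and its cost is bounded by
that of the simulated run. The summand `m` pays for the first insertion, which replaces the arbitrary
initial array by an inflated one. -/
lemma inflate_spec (hP : P m) (hinit : init.Sorted) (hR : R m init ⊆ init.itemFinset)
    (hlen : xs.length = n m) (hnd : xs.Nodup) (hnew : ∀ x ∈ xs, x ∉ init.itemFinset)
    (hm : #(R m init) + 2 * n m + #init.itemFinset ≤ m) {B : ℕ}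
    (hB : FillerBound (R m init) (init.itemFinset \ R m init) B) (ω : A'.Seed)
    (hA' : ∀ i ≤ #(R m init) + n m,
      (A'.arrayAfter ω (empty U (2 * (#(R m init) + n m)))
        ((R m init).toList ++ evictions (R m init) (init.itemFinset \ R m init) xs) i).Sorted ∧
      (A'.arrayAfter ω (empty U (2 * (#(R m init) + n m)))
        ((R m init).toList ++ evictions (R m init) (init.itemFinset \ R m init) xs) i).items =
      {x | x ∈ ((R m init).toList ++
        evictions (R m init) (init.itemFinset \ R m init) xs).take i}) :
    (∀ i ≤ n m, ((A'.inflate P n R).arrayAfter ω init xs i).Sorted ∧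
      ((A'.inflate P n R).arrayAfter ω init xs i).items = init.items ∪ {x | x ∈ xs.take i}) ∧
    (A'.inflate P n R).totalCost ω init xs ≤ m + n m * B + (B + 1) *
      A'.totalCost ω (empty U (2 * (#(R m init) + n m)))
        ((R m init).toList ++ evictions (R m init) (init.itemFinset \ R m init) xs) := by
  have hafter := arrayAfter_inflate (A' := A') (n := n) (R := R) (init := init) (xs := xs) hP ω
  set O := R m init with hO
  set N := init.itemFinset \ O with hN
  set L := O.toList ++ evictions O N xs with hL
  set a : ℕ → SlotArray U (2 * (#O + n m)) :=
    fun i => A'.arrayAfter ω (empty U _) L (#O + i) with ha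
  set F : ℕ → Finset U := fun i => init.itemFinset ∪ (xs.take i).toFinset with hF
  have hON : O ∪ N = init.itemFinset := union_sdiff_of_subset hR
  have hunion : ∀ i, (split O N (xs.take i)).1 ∪ (split O N (xs.take i)).2 = F i := by
    intro i
    rw [split_union, hON]
  have hsorted : ∀ i ≤ n m, (a i).Sorted := fun i hi => (hA' (#O + i) (by omega)).1
  have hitems : ∀ i ≤ n m, (a i).items = (split O N (xs.take i)).1 := by
    intro i hi
    rw [ha, (hA' (#O + i) (by omega)).2, hL, ← length_toList, List.take_length_add_append,
      ← evictions_take, split_fst]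
    ext x
    simp
  have hcases : ∀ i ≤ n m, ∀ y ∈ F i, y ∈ (a i).items ∨ y ∈ (split O N (xs.take i)).2 := by
    intro i hi y hy
    rw [← hunion i] at hy
    rw [hitems i hi]
    exact mem_union.1 hy
  have hcard : ∀ i, #(split O N (xs.take i)).2 = #N := by
    intro i
    refine card_split_snd (hnd.sublist (List.take_sublist _ _)) fun x hx => ?_
    rw [hON]
    exact hnew x (List.mem_of_mem_take hx)
  have hNcard : #N + #O = #init.itemFinset := card_sdiff_add_card_eq_card hR
  constructor
  · intro i hi
    cases i with
    | zero => simpa [arrayAfter] using hinit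
    | succ i =>
      have hmono := slotNumber_strictMonoOn (hsorted _ hi) (hcases _ hi)
      rw [hafter]
      refine ⟨arrange_sorted hmono, ?_⟩
      rw [arrange_items hmono (fun y hy => slotNumber_pos (hcases _ hi y hy)),
        coe_itemFinset_union_take]
      intro y _
      refine (slotNumber_le _ _ _).trans ?_
      rw [hcard]
      omega
  · have hstep : ∀ i ∈ range xs.length,
        ((A'.inflate P n R).arrayAfter ω init xs i).moves
          ((A'.inflate P n R).arrayAfter ω init xs (i + 1)) ≤
        ((if i = 0 then m else 0) + B) + (B + 1) * (a i).moves (a (i + 1)) := by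
      intro i hi
      rw [mem_range] at hi
      cases i with
      | zero =>
        refine (moves_le _ _).trans ?_
        rw [if_pos rfl]
        omega
      | succ i =>
        have htake : xs.take (i + 1 + 1) = xs.take (i + 1) ++ [xs[i + 1]] :=
          List.take_succ_eq_append_getElem hi
        have hz : xs[i + 1] ∉ F (i + 1) := by
          simp only [hF, mem_union, List.mem_toFinset, not_or]
          refine ⟨hnew _ (List.getElem_mem hi), ?_⟩
          have h := hnd.sublist (List.take_sublist (i + 1 + 1) xs)
          rw [htake, List.nodup_append] at h
          exact fun hmem => h.2.2 _ hmem _ (List.mem_singleton_self _) rfl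
        have hF' : F (i + 1 + 1) = insert xs[i + 1] (F (i + 1)) := by
          simp only [hF, htake, List.toFinset_append]
          ext x
          simp only [mem_union, List.mem_toFinset, mem_insert, List.mem_singleton]
          tauto
        have hb := hitems (i + 1 + 1) (by omega)
        have hsp := split_concat (xs.take (i + 1)) xs[i + 1] O N
        rw [← htake] at hsp
        rw [hafter, hafter, if_neg (Nat.succ_ne_zero i), zero_add, hsp]
        rw [hsp] at hb
        exact moves_arrange_evict_le (hunion (i + 1)) hF' hz (hB.split _)
          (hsorted _ (by omega)) (hsorted _ (by omega)) (hitems _ (by omega))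
          (by rw [hb, coe_insert])
    have hLlen : L.length = #O + n m := by
      rw [hL, List.length_append, length_toList, length_evictions, hlen]
    -- The moves of `A'` during the insertion of the initial anchors are not needed.
    have htail : ∑ i ∈ range (n m), (a i).moves (a (i + 1)) ≤
        A'.totalCost ω (empty U (2 * (#O + n m))) L := by
      rw [totalCost, hLlen, sum_range_add]
      exact Nat.le_add_left _ _
    refine (Finset.sum_le_sum hstep).trans ?_
    rw [sum_add_distrib, sum_add_distrib, ← mul_sum, hlen, sum_const, card_range, smul_eq_mul,
      sum_ite_eq']
    refine add_le_add (Nat.add_le_add_right ?_ _) (Nat.mul_le_mul_left _ htail)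
    split_ifs
    · exact le_rfl
    · exact Nat.zero_le m

end Algorithm

lemma floor_add_ceil_le {m : ℕ} {δ : ℝ} (hδ : 0 < δ) (hδ' : δ ≤ 1 / 2) :
    ⌊(1 - δ) * (m : ℝ)⌋₊ + ⌈δ * (m : ℝ) / 3⌉₊ ≤ m := by
  have hm : (0 : ℝ) ≤ m := Nat.cast_nonneg m
  have h1 : (⌊(1 - δ) * (m : ℝ)⌋₊ : ℝ) ≤ (1 - δ) * m :=
    Nat.floor_le (mul_nonneg (by linarith) hm)
  have h2 : ⌊(1 - δ) * (m : ℝ)⌋₊ ≤ m := by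
    have : (⌊(1 - δ) * (m : ℝ)⌋₊ : ℝ) ≤ m := by nlinarith
    exact_mod_cast this
  have h3 : ⌈δ * (m : ℝ) / 3⌉₊ ≤ m - ⌊(1 - δ) * (m : ℝ)⌋₊ := by
    rw [Nat.ceil_le, Nat.cast_sub h2]
    nlinarith
  omega
lemma total_cost_bound {m n r B δ s t : ℝ} (hδ : 0 < δ) (hδ' : δ ≤ 1 / 2) (hn : δ * m / 3 ≤ n)
    (hr0 : 0 ≤ r + n) (hr : r + n ≤ 3 * n) (hn0 : 0 ≤ n) (hB : B ≤ 7 / δ) (hs : 1 ≤ s) (hst : s ≤ t) :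
    m + n * B + (B + 1) * ((r + n) * s) ≤ n * (24 * (t / δ + 1 / δ)) := by
  have hδ1 : 1 ≤ 1 / δ := by rw [le_div_iff₀ hδ]; linarith
  have h1 : m ≤ n * (3 / δ) := by
    rw [← mul_div_assoc, le_div_iff₀ hδ]
    linarith
  have h2 : n * B ≤ n * (7 / δ) := mul_le_mul_of_nonneg_left hB hn0
  have h3 : (r + n) * s ≤ (3 * n) * t :=
    mul_le_mul (by linarith) hst (by linarith ) (by linarith)
  have h4 : B + 1 ≤ 8 / δ := by
    have : 8 / δ = 7 / δ + 1 / δ := by ring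
    linarith
  have h5 : (B + 1) * ((r + n) * s) ≤ 8 / δ * ((3 * n) * t) :=
    mul_le_mul h4 h3 (mul_nonneg hr0 (by linarith))
      (by positivity)
  have h6 : n * (24 * (t / δ + 1 / δ)) =
      8 / δ * ((3 * n) * t) + n * (3 / δ) + n * (7 / δ) + n * (14 / δ) := by ring
  have h7 : 0 ≤ n * (14 / δ) := by positivity
  linarith

lemma exists_canInsert {U : Type u} [LinearOrder U] {t : ℕ → ℝ}
    (ht1 : ∀ n : ℕ, 1 ≤ n → 1 ≤ t n) (htmono : MonotoneOn t (Set.Ici 1)) {A' : Algorithm.{u, v} U}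
    (hA' : ∀ n : ℕ, 1 ≤ n → A'.CanInsert (2 * n) 0 n (t n)) {δ : ℝ} (hδ : 0 < δ)
    (hδ' : δ ≤ 1 / 2) :
    ∃ A : Algorithm.{u, v} U, ∀ m : ℕ, 1 ≤ m →
      A.CanInsert m ⌊(1 - δ) * (m : ℝ)⌋₊ ⌈δ * (m : ℝ) / 3⌉₊ (24 * (t m / δ + 1 / δ)) := by
  -- At most `δ m / 6` anchors are then chosen, so that two slots for each anchor and each of the at
  -- most `δ m / 3 + 1` new items, plus one for each filler, fit into `m` slots once `12 ≤ δ m`.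
  set B := ⌈6 / δ⌉₊ with hBdef
  choose R hRsub hRcard hRB using fun (m : ℕ) (init : SlotArray U m) =>
    exists_anchors init.itemFinset B
  refine ⟨A'.inflate (fun m => 12 ≤ δ * m) (fun m => ⌈δ * (m : ℝ) / 3⌉₊) R, ?_⟩
  intro m hm init hinit hk xs hlen hnd hnew
  have hm0 : (1 : ℝ) ≤ m := by exact_mod_cast hm
  have htm := ht1 m hm
  have hn : δ * (m : ℝ) / 3 ≤ (⌈δ * (m : ℝ) / 3⌉₊ : ℝ) := Nat.le_ceil _
  have hn' : (⌈δ * (m : ℝ) / 3⌉₊ : ℝ) < δ * (m : ℝ) / 3 + 1 := Nat.ceil_lt_add_one (by positivity)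
  by_cases hP : 12 ≤ δ * (m : ℝ)
  · have hBle : (B : ℝ) ≤ 7 / δ := by
      have h1 : (B : ℝ) < 6 / δ + 1 := Nat.ceil_lt_add_one (by positivity)
      have h2 : (1 : ℝ) ≤ 1 / δ := by rw [le_div_iff₀ hδ]; linarith
      have h3 : 7 / δ = 6 / δ + 1 / δ := by ring
      linarith
    have hcardk : #init.itemFinset = ⌊(1 - δ) * (m : ℝ)⌋₊ := by
      rw [← hk, ← SlotArray.coe_itemFinset, Set.ncard_coe_finset]
    have hk1 : (#init.itemFinset : ℝ) ≤ (1 - δ) * m := by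
      rw [hcardk]
      exact Nat.floor_le (mul_nonneg (by linarith) (by linarith))
    have hRle : (#(R m init) : ℝ) ≤ δ * m / 6 := by
      have h1 : (#(R m init) : ℝ) * B ≤ #init.itemFinset := by exact_mod_cast hRcard m init
      have h2 : 6 / δ ≤ (B : ℝ) := Nat.le_ceil _
      have h3 : (#(R m init) : ℝ) * (6 / δ) ≤ m := by
        have := mul_le_mul_of_nonneg_left h2 (Nat.cast_nonneg (α := ℝ) #(R m init))
        nlinarith
      rw [← mul_div_assoc, div_le_iff₀ hδ] at h3
      linarith
    set n := ⌈δ * (m : ℝ) / 3⌉₊ with hndef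
    set r := #(R m init) with hr
    set L := (R m init).toList ++ evictions (R m init) (init.itemFinset \ R m init) xs with hL
    have hfit : r + 2 * n + #init.itemFinset ≤ m := by
      have : (r + 2 * n + #init.itemFinset : ℝ) ≤ m := by linarith
      exact_mod_cast this
    have hn1 : 1 ≤ n := by
      have : (0 : ℝ) < n := by linarith
      exact_mod_cast this
    have hnew' : ∀ x ∈ xs, x ∉ init.itemFinset := fun x hx h =>
      hnew x hx (by rw [← SlotArray.coe_itemFinset]; exact h)
    have hLnodup : L.Nodup := by
      obtain ⟨h1, h2⟩ := nodup_evictions (zs := xs) (disjoint_sdiff (s := R m init)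
        (t := init.itemFinset)) hnd (by rwa [union_sdiff_of_subset (hRsub m init)])
      refine List.nodup_append.2 ⟨nodup_toList _, h1, ?_⟩
      rintro x hx _ hy rfl
      exact h2 x hy (mem_toList.1 hx)
    have hsim := hA' (r + n) (by omega) _ SlotArray.empty_sorted
      (by rw [SlotArray.empty_items, Set.ncard_empty]) L
      (by rw [hL, List.length_append, length_toList, length_evictions, hlen]) hLnodup
      (by simp [SlotArray.empty_items])
    have hspec := fun ω : A'.Seed => Algorithm.inflate_spec (A' := A')
      (P := fun m : ℕ => 12 ≤ δ * (m : ℝ)) (n := fun m : ℕ => ⌈δ * (m : ℝ) / 3⌉₊) (R := R) hP hinit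
      (hRsub m init) hlen hnd hnew' hfit (hRB m init) ω fun i hi => by
        have h := hsim.1 ω i hi
        rw [SlotArray.empty_items, Set.empty_union] at h
        exact h
    refine ⟨fun ω => (hspec ω).1, ?_⟩
    have htn : t (r + n) ≤ t m := htmono (Set.mem_Ici.2 (by omega)) (Set.mem_Ici.2 hm) (by omega)
    have hn0 : (0 : ℝ) ≤ n := Nat.cast_nonneg n
    calc ∫⁻ ω, ((A'.inflate _ _ R).totalCost ω init xs : ℝ≥0∞) ∂A'.law
        ≤ ∫⁻ ω, (((m + n * B : ℕ) : ℝ≥0∞) + ((B + 1 : ℕ) : ℝ≥0∞) *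
            (A'.totalCost ω (SlotArray.empty U (2 * (r + n))) L : ℝ≥0∞)) ∂A'.law := by
          refine lintegral_mono fun ω => ?_
          refine (Nat.cast_le.2 (hspec ω).2).trans_eq ?_
          rw [Nat.cast_add, Nat.cast_mul]
      _ = ((m + n * B : ℕ) : ℝ≥0∞) + ((B + 1 : ℕ) : ℝ≥0∞) * ∫⁻ ω,
            (A'.totalCost ω (SlotArray.empty U (2 * (r + n))) L : ℝ≥0∞) ∂A'.law := by
          rw [lintegral_add_left measurable_const, lintegral_const, measure_univ, mul_one,
            lintegral_const_mul' _ _ (ENNReal.natCast_ne_top _)]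
      _ ≤ ENNReal.ofReal ((m + n * B : ℕ) : ℝ) + ENNReal.ofReal ((B + 1 : ℕ) : ℝ) *
            ENNReal.ofReal ((r + n : ℕ) * t (r + n)) := by
          rw [ENNReal.ofReal_natCast, ENNReal.ofReal_natCast]
          gcongr
          exact hsim.2
      _ = ENNReal.ofReal (((m + n * B : ℕ) : ℝ) + ((B + 1 : ℕ) : ℝ) *
            ((r + n : ℕ) * t (r + n))) := by
          have := ht1 (r + n) (by omega)
          rw [ENNReal.ofReal_add (by positivity) (by positivity),
            ENNReal.ofReal_mul (Nat.cast_nonneg (B + 1))]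
      _ ≤ ENNReal.ofReal (n * (24 * (t m / δ + 1 / δ))) := by
          refine ENNReal.ofReal_le_ofReal ?_
          push_cast
          exact total_cost_bound hδ hδ' hn (by positivity) (by linarith) hn0 hBle (ht1 _ (by omega)) htn
  · refine Algorithm.canInsert_inflate_packed hP (floor_add_ceil_le hδ hδ') ?_ init hinit hk xs hlen
      hnd hnew
    have h1 : (m : ℝ) ≤ 12 * (1 / δ) := by
      rw [mul_one_div, le_div_iff₀ hδ]
      linarith
    have h2 : 0 ≤ t m / δ := by positivity
    have h3 : 0 ≤ 1 / δ := by positivity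
    linarith

end ListLabeling

theorem mainTheorem8 :
    ∃ C : ℝ, 0 < C ∧
      ∀ (U : Type u) [LinearOrder U] (t : ℕ → ℝ),
        (∀ n : ℕ, 1 ≤ n → 1 ≤ t n) → MonotoneOn t (Set.Ici 1) →
        ∀ A' : ListLabeling.Algorithm.{u, v} U,
          (∀ n : ℕ, 1 ≤ n → A'.CanInsert (2 * n) 0 n (t n)) →
          ∀ δ : ℝ, 0 < δ → δ ≤ 1 / 2 →
            ∃ A : ListLabeling.Algorithm.{u, v} U,
              ∀ m : ℕ, 1 ≤ m →
                A.CanInsert m ⌊(1 - δ) * (m : ℝ)⌋₊ ⌈δ * (m : ℝ) / 3⌉₊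
                  (C * (t m / δ + 1 / δ)) := by
  exact ⟨24, by norm_num, fun _ _ _ ht1 htmono _ hA' _ hδ hδ' =>
    ListLabeling.exists_canInsert ht1 htmono hA' hδ hδ'⟩
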